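/- **Setting.** Let $\mathsf{X}\subset\mathbb{R}^m$ be compact with its Borel $\sigma$-algebra and a finite measure $\rho$, and let $A,B_0:\mathsf{X}\to\mathbb{R}$ and $B:\mathsf{X}\times\mathsf{X}\to\mathbb{R}$ be bounded measurable functions with $B(x,y)=B(y,x)$ and $B(x,x)=B_0(x)$. Let $\mathcal{S}$ be a countably infinite, linearly ordered set. Let $\mathcal{M}$ be the space of symmetric matrices $\theta:\mathcal{S}\times\mathcal{S}\to\mathbb{R}$ with $\sum_{\ell\ne s}|\theta(s,\ell)|<\infty$ for every $s$, and let $\mathcal{M}_1$ be the space of the $\theta\in\mathcal{M}$ with $\|\theta\|_1=\sum_{s\le \ell}|\theta(s,\ell)|<\infty$. For $N\subseteq\mathcal{S}\setminus\{s\}$, put $$f^{(s)}_\theta(u\mid x_N)=\frac1Z\exp\Big\{A(u)+\theta(s,s)B_0(u)+\sum_{\ell\in N}\theta(s,\ell)B(u,x_\ell)\Big\},$$ where $Z=Z(\theta,s,x_N)$ makes this a probability density in $u$ with respect to $\rho$. Let $\theta_\star\in\mathcal{M}$, and let $\mu$ be a probability measure on $\mathsf{X}^{\mathcal{S}}$ under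 which, for every $s$, the conditional distribution of $X_s$ given $(X_\ell)_{\ell\neq s}$ has density $f^{(s)}_{\theta_\star}(\cdot\mid X_{\mathcal{S}\setminus\{s\}})$ with respect to $\rho$. Let $X^{(1)},X^{(2)},\dots$ be i.i.d. random fields with law $\mu$, let $D_1\subseteq D_2\subseteq\cdots$ be finite sets with union $\mathcal{S}$, let $q_\lambda:[0,\infty)\to[0,\infty)$, $\lambda\ge0$, be penalty functions, and let $\lambda_n>0$. For $\theta\in\mathcal{M}_1$ define $$U_n(\theta)=\frac1n\sum_{i=1}^n\sum_{s\in D_n}\Big(\log f^{(s)}_{\theta_\star}(X^{(i)}_s\mid X^{(i)}_{D_n\setminus\{s\}})-\log f^{(s)}_{\theta_\star+\theta}(X^{(i)}_s\mid X^{(i)}_{D_n\setminus\{s\}})\Big)+\frac1n\sum_{s,\ell\in D_n,\ s\le\ell}\Big(q_{\lambda_n}(|\theta_\star(s,\ell)+\theta(s,\ell)|)-q_{\lambda_n}(|\theta_\star(s,\ell)|)\Big),$$ $$k(\theta_\star,\theta)=\sum_{s\in\mathcal{S}}k^{(s)}(\theta_\star,\theta),\qquad k^{(s)}(\theta_\star,\theta)=\int\!\int_{\mathsf{X}}-\log\frac{f^{(s)}_{\theta_\star+\theta}(u\mid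 x_{\mathcal{S}\setminus\{s\}})}{f^{(s)}_{\theta_\star}(u\mid x_{\mathcal{S}\setminus\{s\}})}\,f^{(s)}_{\theta_\star}(u\mid x_{\mathcal{S}\setminus\{s\}})\,\rho(du)\,\mu(dx).$$ **Theorem.** Assume that 1. for every $\lambda\ge0$, $q_\lambda(0)=0$ and $q_\lambda$ is right-continuous at $0$ and differentiable on $(0,\infty)$, and $\sup_{\lambda>0}\sup_{x>0}|q_\lambda'(x)|/\lambda<\infty$; 2. for every $s\in\mathcal{S}$, the set $\{\ell\neq s:\theta_\star(s,\ell)\neq0\}$ is finite; 3. $\lambda_n/n\to0$ as $n\to\infty$. Then, for every $\theta\in\mathcal{M}_1$, the series defining $k(\theta_\star,\theta)$ converges, and, almost surely, $U_n$ epi-converges ($\Gamma$-converges) to $k(\theta_\star,\cdot)$ in $(\mathcal{M}_1,\|\cdot\|_1)$; that is, almost surely, for all $\theta\in\mathcal{M}_1$, $$\sup_{j\ge1}\limsup_{n\to\infty}\inf_{\|\vartheta-\theta\|_1<1/j}U_n(\vartheta)\ \le\ k(\theta_\star,\theta)\ \le\ \sup_{j\ge1}\liminf_{n\to\infty}\inf_{\|\vartheta-\theta\|_1<1/j}U_n(\vartheta).$$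 -/

import Mathlib

open MeasureTheory ProbabilityTheory Filter Topology

/-! ### Epi-convergence (Γ-convergence) on a metric space -/

section Epi

variable {V : Type*} [PseudoMetricSpace V]

/-- The epi-limit inferior `sup_{k ≥ 1} liminf_n inf_{v ∈ B(x, 1/k)} f_n(v)`. -/
noncomputable def epiLiminf (f : ℕ → V → EReal) (x : V) : EReal :=
  ⨆ k : ℕ, liminf (fun n => ⨅ v ∈ Metric.ball x (1 / ((k : ℝ) + 1)), f n v) atTop

/-- The epi-limit superior `sup_{k ≥ 1} limsup_n inf_{v ∈ B(x, 1/k)} f_n(v)`. -/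
noncomputable def epiLimsup (f : ℕ → V → EReal) (x : V) : EReal :=
  ⨆ k : ℕ, limsup (fun n => ⨅ v ∈ Metric.ball x (1 / ((k : ℝ) + 1)), f n v) atTop

/-- `f_n` epi-converges (Γ-converges) to `g`. -/
def EpiConverges (f : ℕ → V → EReal) (g : V → EReal) : Prop :=
  ∀ x, epiLimsup f x ≤ g x ∧ g x ≤ epiLiminf f x

end Epi

/-! ### Infinite matrices -/

/-- The neighborhood of `s`: the `ℓ ≠ s` with `θ(s, ℓ) ≠ 0`. -/
def matNeighborhood {S : Type*} (θ : S → S → ℝ) (s : S) : Set S :=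
  {ℓ | ℓ ≠ s ∧ θ s ℓ ≠ 0}

/-- The space `ℳ` of symmetric infinite matrices all of whose nodes have finite degree
`∑_{ℓ ≠ s} |θ(s, ℓ)|`. -/
def InfMat (S : Type*) : AddSubgroup (S → S → ℝ) where
  carrier := {θ | (∀ s ℓ, θ s ℓ = θ ℓ s) ∧
    ∀ s, Summable fun ℓ : {ℓ : S // ℓ ≠ s} => |θ s ℓ|}
  zero_mem' := by
    refine ⟨fun _ _ => rfl, fun s => ?_⟩
    simp
  add_mem' := by
    rintro a b ⟨ha, ha'⟩ ⟨hb, hb'⟩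
    refine ⟨fun s ℓ => by simp [ha s ℓ, hb s ℓ], fun s => ?_⟩
    exact Summable.of_nonneg_of_le (fun _ => abs_nonneg _)
      (fun _ => abs_add_le _ _) ((ha' s).add (hb' s))
  neg_mem' := by
    rintro a ⟨ha, ha'⟩
    refine ⟨fun s ℓ => by simp [ha s ℓ], fun s => ?_⟩
    simpa using ha' s

/-- The ordered pairs `(s, ℓ)` with `s ≤ ℓ`. -/
abbrev OrdPair (S : Type*) [LinearOrder S] : Type _ := {p : S × S // p.1 ≤ p.2}

/-- The elements of `ℳ` with `∑_{s ≤ ℓ} |θ(s, ℓ)| < ∞`. -/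
def InfMatL1 (S : Type*) [LinearOrder S] : AddSubgroup (S → S → ℝ) where
  carrier := {θ | θ ∈ InfMat S ∧ Summable fun p : OrdPair S => |θ p.1.1 p.1.2|}
  zero_mem' := ⟨(InfMat S).zero_mem, by simp⟩
  add_mem' := by
    rintro a b ⟨ha, ha'⟩ ⟨hb, hb'⟩
    exact ⟨(InfMat S).add_mem ha hb, Summable.of_nonneg_of_le (fun _ => abs_nonneg _)
      (fun _ => abs_add_le _ _) (ha'.add hb')⟩
  neg_mem' := by
    rintro a ⟨ha, ha'⟩
    exact ⟨(InfMat S).neg_mem ha, by simpa using ha'⟩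

/-- The space `ℳ₁` as a type of its own, so that its topology is the one of the norm `‖·‖₁`
and not the product topology. -/
def M1 (S : Type*) [LinearOrder S] : Type _ := InfMatL1 S

namespace M1

variable {S : Type*} [LinearOrder S]

instance : CoeFun (M1 S) (fun _ => S → S → ℝ) := ⟨fun θ => θ.1⟩

instance : AddCommGroup (M1 S) := inferInstanceAs (AddCommGroup (InfMatL1 S))

/-- The norm `‖θ‖₁ = ∑_{s ≤ ℓ} |θ(s, ℓ)|`. -/
noncomputable def l1Norm : AddGroupNorm (M1 S) where
  toFun θ := ∑' p : OrdPair S, |θ p.1.1 p.1.2|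
  map_zero' := by
    have h : ∀ p : OrdPair S, |(0 : M1 S) p.1.1 p.1.2| = 0 := fun p => abs_zero
    simp only [h, tsum_zero]
  add_le' a b := by
    have h1 := a.2.2
    have h2 := b.2.2
    rw [← h1.tsum_add h2]
    exact (a + b).2.2.tsum_le_tsum (fun p => abs_add_le _ _) (h1.add h2)
  neg' a := tsum_congr fun p => abs_neg (a p.1.1 p.1.2)
  eq_zero_of_map_eq_zero' a h := by
    have h0 := (a.2.2.hasSum_iff.2 h)
    rw [hasSum_zero_iff_of_nonneg (fun _ => abs_nonneg _)] at h0
    refine Subtype.ext (funext fun s => funext fun ℓ => ?_)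
    rcases le_total s ℓ with hs | hs
    · exact abs_eq_zero.1 (congrFun h0 ⟨(s, ℓ), hs⟩)
    · rw [a.2.1.1 s ℓ]
      exact abs_eq_zero.1 (congrFun h0 ⟨(ℓ, s), hs⟩)

noncomputable instance : NormedAddCommGroup (M1 S) := l1Norm.toNormedAddCommGroup

end M1

/-! ### Auto-models -/

/-- The known data of an auto-model on a sample space `𝕏`: the reference measure `ρ` and the
functions `A`, `B₀`, `B`. -/
structure AutoModel (𝕏 : Type*) [MeasurableSpace 𝕏] where
  /-- reference measure -/
  ρ : Measure 𝕏
  /-- the function `A` -/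
  A : 𝕏 → ℝ
  /-- the function `B₀` -/
  B₀ : 𝕏 → ℝ
  /-- the interaction function `B` -/
  B : 𝕏 → 𝕏 → ℝ

namespace AutoModel

variable {𝕏 : Type*} [MeasurableSpace 𝕏] {S : Type*} (E : AutoModel 𝕏)

/-- `A(u) + θ(s,s) B₀(u) + ∑_{ℓ ∈ N} θ(s,ℓ) B(u, x_ℓ)`, for a set of nodes `N`. -/
noncomputable def localEnergy (θ : S → S → ℝ) (N : Set S) (s : S) (u : 𝕏) (x : S → 𝕏) : ℝ :=
  E.A u + θ s s * E.B₀ u + ∑' ℓ : N, θ s ℓ * E.B u (x ℓ)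

/-- The density, with respect to `ρ` and at the point `u`, proportional to the exponential of
the local energy at `s` given the coordinates `x_ℓ`, `ℓ ∈ N`. -/
noncomputable def condDensity (θ : S → S → ℝ) (N : Set S) (s : S) (u : 𝕏) (x : S → 𝕏) : ℝ :=
  Real.exp (E.localEnergy θ N s u x) / ∫ v, Real.exp (E.localEnergy θ N s v x) ∂E.ρ

/-- The full conditional density `f_θ^{(s)}(u | x_{S ∖ {s}})`. -/
noncomputable def fullDensity (θ : S → S → ℝ) (s : S) (u : 𝕏) (x : S → 𝕏) : ℝ :=
  E.condDensity θ {s}ᶜ s u x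

/-- The approximate full conditional density `f_θ^{(s)}(u | x_{D ∖ {s}})` for a finite set `D`
of observed nodes. -/
noncomputable def approxDensity (D : Finset S) (θ : S → S → ℝ) (s : S) (u : 𝕏) (x : S → 𝕏) : ℝ :=
  E.condDensity θ ((D : Set S) \ {s}) s u x

/-- `μ` is a law of the infinite-volume auto-model with network `θ`: under `μ`, for each node `s`,
the conditional distribution of `X_s` given `σ(X_ℓ, ℓ ≠ s)` has density `f_θ^{(s)}(· | x)` with
respect to `ρ`. It is written through the conditional expectations of the bounded measurable
functions of the whole field. -/
def IsFieldLaw [DecidableEq S] (θ : S → S → ℝ) (μ : Measure (S → 𝕏)) : Prop :=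
  IsProbabilityMeasure μ ∧
  ∀ s : S, ∀ h : (S → 𝕏) → ℝ, Measurable h → (∃ C, ∀ x, |h x| ≤ C) →
    μ[h | cylinderEvents ({s}ᶜ : Set S)] =ᵐ[μ]
      fun x => ∫ u, h (Function.update x s u) * E.fullDensity θ s u x ∂E.ρ

/-- The conditional Kullback-Leibler divergence `k^{(s)}(θ⋆, θ)` at the node `s`, where the
expectation is with respect to the law `μ` of the field. -/
noncomputable def condKL (μ : Measure (S → 𝕏)) (θs θ : S → S → ℝ) (s : S) : ℝ :=
  ∫ x, ∫ u, -Real.log (E.fullDensity (θs + θ) s u x / E.fullDensity θs s u x)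
      * E.fullDensity θs s u x ∂E.ρ ∂μ

/-- `k(θ⋆, θ) = ∑_s k^{(s)}(θ⋆, θ)`. -/
noncomputable def totalKL (μ : Measure (S → 𝕏)) (θs θ : S → S → ℝ) : ℝ :=
  ∑' s : S, E.condKL μ θs θ s

/-- The normalized negative penalized pseudo-likelihood contrast `U_n(θ)`, computed from the
observations `x_0, …, x_{n-1}` on the observed nodes `D`, with penalty function `q`. -/
noncomputable def contrast [LinearOrder S] (D : Finset S) (q : ℝ → ℝ)
    (θs : S → S → ℝ) (n : ℕ) (x : ℕ → S → 𝕏) (θ : S → S → ℝ) : ℝ :=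
  (n : ℝ)⁻¹ * ∑ i ∈ Finset.range n, ∑ s ∈ D,
      (Real.log (E.approxDensity D θs s (x i s) (x i))
        - Real.log (E.approxDensity D (θs + θ) s (x i s) (x i)))
    + (n : ℝ)⁻¹ * ∑ p ∈ (D ×ˢ D).filter (fun p => p.1 ≤ p.2),
      (q |θs p.1 p.2 + θ p.1 p.2| - q |θs p.1 p.2|)

end AutoModel

/-- The condition on the family `q_λ : [0, ∞) → [0, ∞)`, `λ ≥ 0`, of penalty functions. -/
structure IsPenaltyFamily (q : ℝ → ℝ → ℝ) : Prop where
  nonneg : ∀ lam, 0 ≤ lam → ∀ x, 0 ≤ x → 0 ≤ q lam x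
  zero : ∀ lam, 0 ≤ lam → q lam 0 = 0
  right_cont : ∀ lam, 0 ≤ lam → ContinuousWithinAt (q lam) (Set.Ici 0) 0
  diff : ∀ lam, 0 ≤ lam → ∀ x, 0 < x → DifferentiableAt ℝ (q lam) x
  deriv_bound : ∃ C : ℝ, ∀ lam, 0 < lam → ∀ x, 0 < x → |deriv (q lam) x| / lam ≤ C

/-! The heart of the matter is equi-Lipschitz continuity. The local energy at `s` is affine in row
`s` of the network, with coefficients bounded by `C`, so a perturbation `δ` moves each log
conditional density at `s` by at most `4 * C * rowSum δ s`, uniformly in the field and in the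
conditioning set (`abs_log_condDensity_sub_le`). The row sums of `δ` add up to at most `2‖δ‖₁`, so
the likelihood part of the contrast and the limit are both `8 * C`-Lipschitz on `M1`. The penalty
adds a Lipschitz constant of order `lam n / n`, which vanishes.

For equi-Lipschitz functions pointwise convergence implies epi-convergence
(`epiConverges_of_tendsto_of_lipschitz`), and pointwise convergence need only be checked on a dense
set (`tendsto_of_dense_of_lipschitz`). The dense set is that of the rational, finitely supported
matrices. It is countable, so a single null set serves all its elements. For such a perturbation
only finitely many nodes contribute, and by sparsity of the true network their conditional densities
given the observed nodes equal the full ones once `D n` is large (`eventually_sum_logRatio_eq`).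
What remains is the strong law of large numbers at finitely many nodes, whose limits are conditional
divergences by the tower property (`condKL_eq_integral_logRatio`). -/

namespace AutoModel

variable {𝕏 : Type*} [MeasurableSpace 𝕏] {S : Type*}

/-- The functions of the model are measurable and bounded by `C`, and the reference measure is
finite. -/
structure IsBoundedBy (E : AutoModel 𝕏) (C : ℝ) : Prop where
  finite : IsFiniteMeasure E.ρ
  measurable_A : Measurable E.A
  measurable_B₀ : Measurable E.B₀
  measurable_B : Measurable (Function.uncurry E.B)
  abs_A_le : ∀ x, |E.A x| ≤ C
  abs_B₀_le : ∀ x, |E.B₀ x| ≤ C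
  abs_B_le : ∀ x y, |E.B x y| ≤ C

/-- The absolute row sum `∑_ℓ |θ(s, ℓ)|`. -/
noncomputable def rowSum (θ : S → S → ℝ) (s : S) : ℝ := ∑' ℓ, |θ s ℓ|

/-- All rows of `θ` are absolutely summable. -/
def RowSummable (θ : S → S → ℝ) : Prop := ∀ s, Summable fun ℓ => |θ s ℓ|

theorem RowSummable.add {θ θ' : S → S → ℝ} (h : RowSummable θ) (h' : RowSummable θ') :
    RowSummable (θ + θ') := fun s =>
  Summable.of_nonneg_of_le (fun _ => abs_nonneg _) (fun _ => abs_add_le _ _) ((h s).add (h' s))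

theorem RowSummable.zero : RowSummable (0 : S → S → ℝ) := fun s => by
  simp

theorem RowSummable.sub {θ θ' : S → S → ℝ} (h : RowSummable θ) (h' : RowSummable θ') :
    RowSummable (θ - θ') := fun s =>
  Summable.of_nonneg_of_le (fun _ => abs_nonneg _) (fun _ => abs_sub _ _) ((h s).add (h' s))

theorem rowSum_nonneg (θ : S → S → ℝ) (s : S) : 0 ≤ rowSum θ s :=
  tsum_nonneg fun _ => abs_nonneg _

/-! ### Dependence of the conditional densities on the network -/

namespace IsBoundedBy

variable {E : AutoModel 𝕏} {C : ℝ} (hE : E.IsBoundedBy C)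
  {θ θ' : S → S → ℝ} (hθ : RowSummable θ) (hθ' : RowSummable θ') (N : Set S) (s : S)
include hE

theorem abs_interaction_le (θ : S → S → ℝ) (u : 𝕏) (x : S → 𝕏) (ℓ : S) :
    |θ s ℓ * E.B u (x ℓ)| ≤ |θ s ℓ| * C := by
  rw [abs_mul]
  exact mul_le_mul_of_nonneg_left (hE.abs_B_le _ _) (abs_nonneg _)

theorem measurable_localEnergy [Countable S] :
    Measurable fun p : 𝕏 × (S → 𝕏) => E.localEnergy θ N s p.1 p.2 := by
  unfold localEnergy
  refine ((hE.measurable_A.comp measurable_fst).add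
    ((hE.measurable_B₀.comp measurable_fst).const_mul _)).add ?_
  refine Measurable.tsum fun ℓ => Measurable.const_mul ?_ _
  exact hE.measurable_B.comp (measurable_fst.prodMk ((measurable_pi_apply _).comp measurable_snd))

theorem measurable_condDensity [Countable S] :
    Measurable fun p : 𝕏 × (S → 𝕏) => E.condDensity θ N s p.1 p.2 := by
  have := hE.finite
  have hm := Real.measurable_exp.comp (hE.measurable_localEnergy (θ := θ) N s)
  refine hm.div ?_
  have := hm.stronglyMeasurable.integral_prod_left' (μ := E.ρ)
  exact this.measurable.comp measurable_snd

include hθ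

theorem summable_interaction (u : 𝕏) (x : S → 𝕏) :
    Summable fun ℓ : N => θ s ℓ * E.B u (x ℓ) :=
  Summable.of_norm_bounded (((hθ s).mul_right C).subtype N)
    fun ℓ => hE.abs_interaction_le s θ u x ℓ

include hθ'

/-- `A` cancels and the rest is linear in the matrix. The diagonal term and the interaction sum are
each at most `C` times the row sum, whence the factor 2; `N` is allowed to contain `s`. -/
theorem abs_localEnergy_sub_le (u : 𝕏) (x : S → 𝕏) :
    |E.localEnergy θ N s u x - E.localEnergy θ' N s u x| ≤ 2 * C * rowSum (θ - θ') s := by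
  have hC : 0 ≤ C := (abs_nonneg _).trans (hE.abs_A_le u)
  have hd := hθ.sub hθ'
  have h1 : E.localEnergy θ N s u x - E.localEnergy θ' N s u x
      = (θ - θ') s s * E.B₀ u + ∑' ℓ : N, (θ - θ') s ℓ * E.B u (x ℓ) := by
    have : ∀ ℓ : N, (θ - θ') s ℓ * E.B u (x ℓ)
        = θ s ℓ * E.B u (x ℓ) - θ' s ℓ * E.B u (x ℓ) := fun ℓ => by
      simp [sub_mul]
    simp_rw [this]
    rw [(hE.summable_interaction hθ N s u x).tsum_sub (hE.summable_interaction hθ' N s u x)]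
    simp only [localEnergy, Pi.sub_apply]
    ring
  have h2 : |(θ - θ') s s * E.B₀ u| ≤ rowSum (θ - θ') s * C := by
    rw [abs_mul]
    exact mul_le_mul ((hd s).le_tsum s fun _ _ => abs_nonneg _) (hE.abs_B₀_le u) (abs_nonneg _)
      (rowSum_nonneg _ _)
  have h3 : |∑' ℓ : N, (θ - θ') s ℓ * E.B u (x ℓ)| ≤ rowSum (θ - θ') s * C := by
    have hs : Summable fun ℓ : N => |(θ - θ') s ℓ| * C := ((hd s).mul_right C).subtype N
    refine (tsum_of_norm_bounded (f := fun ℓ : N => (θ - θ') s ℓ * E.B u (x ℓ)) hs.hasSum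
      fun ℓ => hE.abs_interaction_le s (θ - θ') u x ℓ).trans ?_
    rw [rowSum, ← tsum_mul_right]
    exact ((hd s).mul_right C).tsum_subtype_le (fun ℓ => |(θ - θ') s ℓ| * C) N
      (fun _ => mul_nonneg (abs_nonneg _) hC)
  rw [h1]
  linarith [abs_add_le ((θ - θ') s s * E.B₀ u) (∑' ℓ : N, (θ - θ') s ℓ * E.B u (x ℓ))]

omit hθ'

theorem abs_localEnergy_le (u : 𝕏) (x : S → 𝕏) :
    |E.localEnergy θ N s u x| ≤ C + 2 * C * rowSum θ s := by
  have h := hE.abs_localEnergy_sub_le hθ RowSummable.zero N s u x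
  have h0 : E.localEnergy (0 : S → S → ℝ) N s u x = E.A u := by simp [localEnergy]
  rw [h0, sub_zero] at h
  linarith [abs_sub_abs_le_abs_sub (E.localEnergy θ N s u x) (E.A u), hE.abs_A_le u]

theorem integrable_exp_localEnergy [Countable S] (x : S → 𝕏) :
    Integrable (fun v => Real.exp (E.localEnergy θ N s v x)) E.ρ := by
  have := hE.finite
  have hm : Measurable fun v => Real.exp (E.localEnergy θ N s v x) :=
    Real.measurable_exp.comp
      ((hE.measurable_localEnergy N s).comp (measurable_id.prodMk measurable_const))
  refine Integrable.of_bound hm.aestronglyMeasurable (Real.exp (C + 2 * C * rowSum θ s))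
    (Eventually.of_forall fun v => ?_)
  rw [Real.norm_of_nonneg (Real.exp_pos _).le]
  exact Real.exp_le_exp.2 ((le_abs_self _).trans (hE.abs_localEnergy_le hθ N s v x))

theorem partition_pos [Countable S] [NeZero E.ρ] (x : S → 𝕏) :
    0 < ∫ v, Real.exp (E.localEnergy θ N s v x) ∂E.ρ :=
  integral_exp_pos (hE.integrable_exp_localEnergy hθ N s x)

theorem condDensity_pos [Countable S] [NeZero E.ρ] (u : 𝕏) (x : S → 𝕏) :
    0 < E.condDensity θ N s u x :=
  div_pos (Real.exp_pos _) (hE.partition_pos hθ N s x)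

theorem log_condDensity [Countable S] [NeZero E.ρ] (u : 𝕏) (x : S → 𝕏) :
    Real.log (E.condDensity θ N s u x) = E.localEnergy θ N s u x
      - Real.log (∫ v, Real.exp (E.localEnergy θ N s v x) ∂E.ρ) := by
  rw [condDensity, Real.log_div (Real.exp_pos _).ne' (hE.partition_pos hθ N s x).ne', Real.log_exp]

include hθ'

/-- The uniform energy bound becomes a constant factor under the exponential and leaves the
integral. One side suffices, since the networks can be exchanged. -/
theorem log_partition_sub_le [Countable S] [NeZero E.ρ] (x : S → 𝕏) :
    Real.log (∫ v, Real.exp (E.localEnergy θ N s v x) ∂E.ρ)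
      - Real.log (∫ v, Real.exp (E.localEnergy θ' N s v x) ∂E.ρ)
      ≤ 2 * C * rowSum (θ - θ') s := by
  have h : ∫ v, Real.exp (E.localEnergy θ N s v x) ∂E.ρ
      ≤ Real.exp (2 * C * rowSum (θ - θ') s) * ∫ v, Real.exp (E.localEnergy θ' N s v x) ∂E.ρ := by
    rw [← integral_const_mul]
    refine integral_mono (hE.integrable_exp_localEnergy hθ N s x)
      ((hE.integrable_exp_localEnergy hθ' N s x).const_mul _) fun v => ?_
    rw [← Real.exp_add]
    refine Real.exp_le_exp.2 ?_
    linarith [(abs_le.1 (hE.abs_localEnergy_sub_le hθ hθ' N s v x)).2]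
  have hp := hE.partition_pos hθ N s x
  have hp' := hE.partition_pos hθ' N s x
  have := Real.log_le_log hp h
  rw [Real.log_mul (Real.exp_pos _).ne' hp'.ne', Real.log_exp] at this
  linarith

theorem abs_log_condDensity_sub_le [Countable S] [NeZero E.ρ] (u : 𝕏) (x : S → 𝕏) :
    |Real.log (E.condDensity θ N s u x) - Real.log (E.condDensity θ' N s u x)|
      ≤ 4 * C * rowSum (θ - θ') s := by
  have hr : rowSum (θ' - θ) s = rowSum (θ - θ') s := tsum_congr fun ℓ => abs_sub_comm _ _
  have h1 := hE.log_partition_sub_le hθ hθ' N s x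
  have h2 := hE.log_partition_sub_le hθ' hθ N s x
  have h3 := abs_le.1 (hE.abs_localEnergy_sub_le hθ hθ' N s u x)
  rw [hE.log_condDensity hθ, hE.log_condDensity hθ', abs_le]
  rw [hr] at h2
  constructor <;> linarith [h3.1, h3.2]

end IsBoundedBy

/-! ### Log-likelihood ratios and conditional divergences -/

variable (E : AutoModel 𝕏)

/-- The log-likelihood ratio at the node `s` of the networks `θs` and `θs + θ`, given the
coordinates in `N`. -/
noncomputable def logRatio (θs θ : S → S → ℝ) (N : Set S) (s : S) (x : S → 𝕏) : ℝ :=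
  Real.log (E.condDensity θs N s (x s) x) - Real.log (E.condDensity (θs + θ) N s (x s) x)

variable {E} {C : ℝ} {θs θ θ' : S → S → ℝ}

/-- Nodes with zero coefficient contribute neither to the energy nor to the normalization. This is
how sparsity enters. -/
theorem condDensity_congr {N N' : Set S} {s : S} (hN : N' ⊆ N)
    (h : ∀ ℓ ∈ N, θ s ℓ ≠ 0 → ℓ ∈ N') (u : 𝕏) (x : S → 𝕏) :
    E.condDensity θ N s u x = E.condDensity θ N' s u x := by
  have : ∀ v, E.localEnergy θ N s v x = E.localEnergy θ N' s v x := fun v => by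
    simp only [localEnergy]
    congr 1
    rw [tsum_subtype N fun ℓ => θ s ℓ * E.B v (x ℓ), tsum_subtype N' fun ℓ => θ s ℓ * E.B v (x ℓ)]
    refine tsum_congr fun ℓ => ?_
    by_cases h1 : ℓ ∈ N'
    · rw [Set.indicator_of_mem h1, Set.indicator_of_mem (hN h1)]
    · rw [Set.indicator_of_notMem h1]
      by_cases h2 : ℓ ∈ N
      · rw [Set.indicator_of_mem h2, not_not.1 (mt (h ℓ h2) h1), zero_mul]
      · rw [Set.indicator_of_notMem h2]
  simp only [condDensity, this]

theorem condDensity_row_congr {s : S} (h : θ s = θ' s) (N : Set S) (u : 𝕏) (x : S → 𝕏) :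
    E.condDensity θ N s u x = E.condDensity θ' N s u x := by
  simp only [condDensity, localEnergy, h]

theorem condDensity_update [DecidableEq S] (s : S) (u v : 𝕏) (x : S → 𝕏) :
    E.condDensity θ {s}ᶜ s u (Function.update x s v) = E.condDensity θ {s}ᶜ s u x := by
  have : ∀ (w : 𝕏) (ℓ : ({s}ᶜ : Set S)),
      E.B w (Function.update x s v ℓ) = E.B w (x ℓ) := fun w ℓ => by
    rw [Function.update_of_ne ℓ.2]
  simp only [condDensity, localEnergy, this]

theorem logRatio_eq_zero {s : S} (h : θ s = 0) (N : Set S) (x : S → 𝕏) :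
    E.logRatio θs θ N s x = 0 := by
  rw [logRatio, condDensity_row_congr (θ := θs + θ) (θ' := θs) (by simp [h]), sub_self]

theorem logRatio_eq_full {N : Set S} {s : S} (hN : N ⊆ {s}ᶜ)
    (h : ∀ ℓ, ℓ ≠ s → (θs s ℓ ≠ 0 ∨ θ s ℓ ≠ 0) → ℓ ∈ N) (x : S → 𝕏) :
    E.logRatio θs θ N s x = E.logRatio θs θ {s}ᶜ s x := by
  rw [logRatio, logRatio, condDensity_congr hN fun ℓ h1 h2 => h ℓ h1 (Or.inl h2),
    condDensity_congr hN fun ℓ h1 h2 => h ℓ h1 ?_]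
  by_contra hc
  push Not at hc
  exact h2 (by simp [hc.1, hc.2])

namespace IsBoundedBy

variable [Countable S] (hE : E.IsBoundedBy C) (hθs : RowSummable θs) (hθ : RowSummable θ)
  (N : Set S) (s : S)

include hE

theorem measurable_logRatio : Measurable (E.logRatio θs θ N s) := by
  have hm : Measurable fun x : S → 𝕏 => (x s, x) := (measurable_pi_apply s).prodMk measurable_id
  exact (Real.measurable_log.comp ((hE.measurable_condDensity N s).comp hm)).sub
    (Real.measurable_log.comp ((hE.measurable_condDensity N s).comp hm))

include hθs hθ

variable [NeZero E.ρ]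

theorem abs_logRatio_le (x : S → 𝕏) : |E.logRatio θs θ N s x| ≤ 4 * C * rowSum θ s := by
  rw [logRatio, abs_sub_comm]
  simpa using hE.abs_log_condDensity_sub_le (hθs.add hθ) hθs N s (x s) x

theorem integrable_logRatio (μ : Measure (S → 𝕏)) [IsFiniteMeasure μ] :
    Integrable (E.logRatio θs θ N s) μ :=
  Integrable.of_bound (hE.measurable_logRatio N s).aestronglyMeasurable _
    (Eventually.of_forall fun x => hE.abs_logRatio_le hθs hθ N s x)

theorem abs_logRatio_sub_le (hθ' : RowSummable θ') (x : S → 𝕏) :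
    |E.logRatio θs θ N s x - E.logRatio θs θ' N s x| ≤ 4 * C * rowSum (θ - θ') s := by
  rw [logRatio, logRatio, sub_sub_sub_cancel_left, abs_sub_comm]
  simpa using hE.abs_log_condDensity_sub_le (hθs.add hθ) (hθs.add hθ') N s (x s) x

/-- Tower property: the log ratio is a bounded measurable function of the field, so its conditional
expectation given the other nodes is the inner integral of the divergence. The densities ignore the
coordinate at `s`, so resampling it changes only their argument `u`. -/
theorem condKL_eq_integral_logRatio [DecidableEq S] {μ : Measure (S → 𝕏)}
    (hμ : E.IsFieldLaw θs μ) : E.condKL μ θs θ s = ∫ x, E.logRatio θs θ {s}ᶜ s x ∂μ := by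
  have := hμ.1
  rw [← integral_condExp (cylinderEvents_le_pi (Δ := ({s}ᶜ : Set S))),
    integral_congr_ae (hμ.2 s _ (hE.measurable_logRatio {s}ᶜ s)
      ⟨_, hE.abs_logRatio_le hθs hθ {s}ᶜ s⟩), condKL]
  refine integral_congr_ae (Eventually.of_forall fun x => integral_congr_ae
    (Eventually.of_forall fun u => ?_))
  simp only [logRatio, condDensity_update, Function.update_self, fullDensity]
  rw [Real.log_div (hE.condDensity_pos (hθs.add hθ) _ s u x).ne'
    (hE.condDensity_pos hθs _ s u x).ne']
  ring

end IsBoundedBy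

/-- Testing the conditional law on the constant 1 would give 1 = 0 almost everywhere. Nonvanishing
of `ρ` makes the partition functions positive. -/
theorem IsFieldLaw.ρ_ne_zero [DecidableEq S] [Nonempty S] {μ : Measure (S → 𝕏)}
    (hμ : E.IsFieldLaw θs μ) : E.ρ ≠ 0 := by
  intro h0
  have := hμ.1
  obtain ⟨s⟩ := ‹Nonempty S›
  have h := hμ.2 s (fun _ => 1) measurable_const ⟨1, fun _ => by simp⟩
  rw [condExp_const cylinderEvents_le_pi, h0] at h
  obtain ⟨x, hx⟩ := h.exists
  simp at hx

end AutoModel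

/-! ### Epi-convergence of equi-Lipschitz functions -/

section Epi

variable {V : Type*} [PseudoMetricSpace V] {f : ℕ → V → ℝ} {g : V → ℝ} {L L' : ℝ}

theorem tendsto_of_dense_of_lipschitz {T : Set V} (hT : Dense T)
    (hf : ∀ᶠ n in atTop, ∀ v w, |f n v - f n w| ≤ L * dist v w)
    (hg : ∀ v w, |g v - g w| ≤ L' * dist v w)
    (hlim : ∀ v ∈ T, Tendsto (fun n => f n v) atTop (𝓝 (g v))) (v : V) :
    Tendsto (fun n => f n v) atTop (𝓝 (g v)) := by
  rw [Metric.tendsto_atTop']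
  intro ε hε
  -- `L` and `L'` carry no sign; the 1 makes the common constant positive, so that one can divide by
  -- it.
  set M := max 1 (max L L') with hM
  have hM0 : 0 < M := lt_of_lt_of_le one_pos (le_max_left _ _)
  obtain ⟨w, hw, hd⟩ := hT.exists_dist_lt v (show 0 < ε / (3 * M) by positivity)
  have hMd : M * dist v w < ε / 3 := by
    rw [lt_div_iff₀ (by positivity)] at hd
    linarith
  have hL : L * dist v w ≤ M * dist v w :=
    mul_le_mul_of_nonneg_right ((le_max_left _ _).trans (le_max_right _ _)) dist_nonneg
  have hL' : L' * dist v w ≤ M * dist v w :=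
    mul_le_mul_of_nonneg_right ((le_max_right _ _).trans (le_max_right _ _)) dist_nonneg
  have h3 := (Metric.tendsto_nhds.1 (hlim w hw)) (ε / 3) (by positivity)
  obtain ⟨n₀, hn₀⟩ := eventually_atTop.1 (hf.and h3)
  refine ⟨n₀, fun n hn => ?_⟩
  obtain ⟨h1, h2⟩ := hn₀ n hn.le
  rw [Real.dist_eq, abs_lt] at *
  have a := abs_le.1 (h1 v w)
  have b := abs_le.1 (hg v w)
  constructor <;> linarith [a.1, a.2, b.1, b.2, h2.1, h2.2]

/-- The infimum over a ball of radius `r` lies between `f n v - max L 0 * r` and the value `f n v`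
at the centre; let `n → ∞`, then `r → 0`. -/
theorem epiConverges_of_tendsto_of_lipschitz
    (hf : ∀ᶠ n in atTop, ∀ v w, |f n v - f n w| ≤ L * dist v w)
    (hlim : ∀ v, Tendsto (fun n => f n v) atTop (𝓝 (g v))) :
    EpiConverges (fun n v => (f n v : EReal)) (fun v => (g v : EReal)) := by
  have hlim' : ∀ (v : V) (c : ℝ), Tendsto (fun n => ((f n v + c : ℝ) : EReal)) atTop
      (𝓝 ((g v + c : ℝ) : EReal)) := fun v c =>
    (continuous_coe_real_ereal.tendsto _).comp ((hlim v).add_const c)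
  intro v
  constructor
  · refine iSup_le fun k => ?_
    have h := (hlim' v 0).limsup_eq
    simp only [add_zero] at h
    change _ ≤ ((g v : ℝ) : EReal)
    rw [← h]
    exact limsup_le_limsup (Eventually.of_forall fun n =>
      iInf₂_le v (Metric.mem_ball_self Nat.one_div_pos_of_nat))
  · have hk : ∀ k : ℕ, ((g v + -(max L 0 * (1 / ((k : ℝ) + 1))) : ℝ) : EReal)
        ≤ epiLiminf (fun n v => (f n v : EReal)) v := fun k => by
      refine le_trans ?_ (le_iSup _ k)
      rw [← (hlim' v (-(max L 0 * (1 / ((k : ℝ) + 1))))).liminf_eq]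
      refine liminf_le_liminf ?_
      filter_upwards [hf] with n hn
      refine le_iInf₂ fun w hw => EReal.coe_le_coe_iff.2 ?_
      have h1 := (abs_le.1 (hn w v)).1
      have h2 : L * dist w v ≤ max L 0 * (1 / ((k : ℝ) + 1)) :=
        mul_le_mul (le_max_left _ _) (Metric.mem_ball.1 hw).le dist_nonneg (le_max_right _ _)
      linarith
    refine le_of_tendsto' (x := atTop) (f := fun k : ℕ =>
      ((g v + -(max L 0 * (1 / ((k : ℝ) + 1))) : ℝ) : EReal)) ?_ hk
    refine (continuous_coe_real_ereal.tendsto _).comp ?_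
    simpa using ((tendsto_one_div_add_atTop_nhds_zero_nat (𝕜 := ℝ)).const_mul
      (max L 0)).neg.const_add (g v)

end Epi

/-! ### The penalty -/

/-- Mean value theorem on `[x, y]`; right-continuity at 0 covers intervals that start there. -/
theorem IsPenaltyFamily.exists_lipschitz {q : ℝ → ℝ → ℝ} (hq : IsPenaltyFamily q) :
    ∃ C, 0 ≤ C ∧ ∀ lam, 0 < lam → ∀ x y, 0 ≤ x → 0 ≤ y →
      |q lam x - q lam y| ≤ C * lam * |x - y| := by
  obtain ⟨C, hC⟩ := hq.deriv_bound
  have hC0 : 0 ≤ C := (div_nonneg (abs_nonneg _) zero_le_one).trans (hC 1 one_pos 1 one_pos)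
  refine ⟨C, hC0, fun lam hlam => ?_⟩
  have key : ∀ x y, 0 ≤ x → x < y → |q lam y - q lam x| ≤ C * lam * |y - x| := by
    intro x y hx hxy
    have hcont : ContinuousOn (q lam) (Set.Icc x y) := fun z hz => by
      rcases (hx.trans hz.1).eq_or_lt with h | h
      · rw [← h]
        exact (hq.right_cont lam hlam.le).mono fun w hw => hx.trans hw.1
      · exact (hq.diff lam hlam.le z h).continuousAt.continuousWithinAt
    obtain ⟨c, hc, hcd⟩ := exists_deriv_eq_slope (q lam) hxy hcont fun z hz =>
      (hq.diff lam hlam.le z (hx.trans_lt hz.1)).differentiableWithinAt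
    rw [eq_div_iff (sub_pos.2 hxy).ne'] at hcd
    rw [← hcd, abs_mul]
    exact mul_le_mul_of_nonneg_right
      ((div_le_iff₀ hlam).1 (hC lam hlam c (hx.trans_lt hc.1))) (abs_nonneg _)
  intro x y hx hy
  rcases lt_trichotomy x y with h | h | h
  · rw [abs_sub_comm, abs_sub_comm x]
    exact key x y hx h
  · simp [h]
  · exact key y x hy h

/-! ### The space `ℳ₁` -/

namespace M1

variable {S : Type*} [LinearOrder S]

theorem coe_sub (a b : M1 S) : ((a - b : M1 S) : S → S → ℝ) = (a : S → S → ℝ) - b := rfl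

theorem coe_zero : ((0 : M1 S) : S → S → ℝ) = 0 := rfl

theorem symm (θ : M1 S) (s ℓ : S) : θ s ℓ = θ ℓ s := θ.2.1.1 s ℓ

theorem summable (θ : M1 S) : Summable fun p : OrdPair S => |θ p.1.1 p.1.2| := θ.2.2

theorem norm_def (θ : M1 S) : ‖θ‖ = ∑' p : OrdPair S, |θ p.1.1 p.1.2| := rfl

/-- By symmetry the full matrix is covered by its upper triangle and the transpose of it; the
diagonal is counted twice, hence an inequality. -/
theorem hasSum_pairs (θ : M1 S) :
    ∃ a ≤ 2 * ‖θ‖, HasSum (fun p : S × S => |θ p.1 p.2|) a := by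
  set F : S × S → ℝ := fun p => |θ p.1 p.2| with hF
  set G : S × S → ℝ := Set.indicator {p | p.1 ≤ p.2} F with hG
  have h1 : HasSum G ‖θ‖ := hasSum_subtype_iff_indicator.1 θ.summable.hasSum
  have h2 : HasSum (fun p : S × S => G p.swap) ‖θ‖ := (Equiv.prodComm S S).hasSum_iff.2 h1
  have h3 := h1.add h2
  have hG0 : ∀ p, 0 ≤ G p := fun p => Set.indicator_nonneg (fun _ _ => abs_nonneg _) p
  have hle : ∀ p, F p ≤ G p + G p.swap := fun p => by
    rcases le_total p.1 p.2 with h | h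
    · have : G p = F p := Set.indicator_of_mem (s := {p : S × S | p.1 ≤ p.2}) h F
      linarith [hG0 p.swap]
    · have : G p.swap = F p.swap :=
        Set.indicator_of_mem (s := {p : S × S | p.1 ≤ p.2}) (a := p.swap) h F
      have h' : F p.swap = F p := by simp only [hF, Prod.fst_swap, Prod.snd_swap, θ.symm p.2]
      linarith [hG0 p]
  have hs : Summable F := Summable.of_nonneg_of_le (fun _ => abs_nonneg _) hle h3.summable
  exact ⟨_, (hs.tsum_le_tsum hle h3.summable).trans (by rw [h3.tsum_eq]; linarith), hs.hasSum⟩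

theorem rowSummable (θ : M1 S) : AutoModel.RowSummable (θ : S → S → ℝ) := fun s => by
  obtain ⟨a, -, h⟩ := θ.hasSum_pairs
  exact h.summable.prod_factor s

theorem summable_rowSum (θ : M1 S) : Summable (AutoModel.rowSum (θ : S → S → ℝ)) := by
  obtain ⟨a, -, h⟩ := θ.hasSum_pairs
  exact (h.prod_fiberwise fun s => (θ.rowSummable s).hasSum).summable

theorem tsum_rowSum_le (θ : M1 S) : ∑' s, AutoModel.rowSum (θ : S → S → ℝ) s ≤ 2 * ‖θ‖ := by
  obtain ⟨a, ha, h⟩ := θ.hasSum_pairs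
  exact (h.prod_fiberwise fun s => (θ.rowSummable s).hasSum).tsum_eq.trans_le ha

theorem sum_rowSum_le (θ : M1 S) (D : Finset S) :
    ∑ s ∈ D, AutoModel.rowSum (θ : S → S → ℝ) s ≤ 2 * ‖θ‖ :=
  (θ.summable_rowSum.sum_le_tsum D fun s _ => AutoModel.rowSum_nonneg _ s).trans θ.tsum_rowSum_le

theorem sum_pairs_le (θ : M1 S) (D : Finset (S × S)) :
    ∑ p ∈ D.filter (fun p => p.1 ≤ p.2), |θ p.1 p.2| ≤ ‖θ‖ := by
  have h := θ.summable.sum_le_tsum (D.subtype fun p => p.1 ≤ p.2) fun _ _ => abs_nonneg _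
  rwa [Finset.sum_subtype_eq_sum_filter (f := fun p : S × S => |θ p.1 p.2|)] at h

/-- The total variation of a Lipschitz penalty between two perturbations of a network. -/
theorem abs_sum_penalty_sub_le (θ θ' : M1 S) (θs : S → S → ℝ) (D : Finset (S × S)) {q : ℝ → ℝ}
    {R : ℝ} (hR : 0 ≤ R) (hq : ∀ x y, 0 ≤ x → 0 ≤ y → |q x - q y| ≤ R * |x - y|) :
    |∑ p ∈ D.filter (fun p => p.1 ≤ p.2), (q |θs p.1 p.2 + θ p.1 p.2| - q |θs p.1 p.2|)
      - ∑ p ∈ D.filter (fun p => p.1 ≤ p.2), (q |θs p.1 p.2 + θ' p.1 p.2| - q |θs p.1 p.2|)|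
      ≤ R * dist θ θ' := by
  rw [← Finset.sum_sub_distrib]
  refine (Finset.abs_sum_le_sum_abs _ _).trans
    ((Finset.sum_le_sum (g := fun p => R * |(θ - θ') p.1 p.2|) fun p _ => ?_).trans ?_)
  · rw [sub_sub_sub_cancel_right]
    refine (hq _ _ (abs_nonneg _) (abs_nonneg _)).trans (mul_le_mul_of_nonneg_left ?_ hR)
    refine (abs_abs_sub_abs_le_abs_sub _ _).trans (le_of_eq ?_)
    rw [add_sub_add_left_eq_sub]
    rfl
  · rw [← Finset.mul_sum, dist_eq_norm]
    exact mul_le_mul_of_nonneg_left ((θ - θ').sum_pairs_le _) hR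

/-- The symmetric matrix with the given finitely supported upper triangle. -/
noncomputable def ofFinsupp (c : OrdPair S →₀ ℚ) : M1 S :=
  ⟨fun s ℓ => (c ⟨(min s ℓ, max s ℓ), min_le_max⟩ : ℝ), by
    have hfin : (Function.support fun p : S × S =>
        |(c ⟨(min p.1 p.2, max p.1 p.2), min_le_max⟩ : ℝ)|).Finite := by
      have himg := c.support.finite_toSet.image fun p => p.1
      refine (himg.union (himg.image Prod.swap)).subset fun p hp => ?_
      have hp' : (⟨(min p.1 p.2, max p.1 p.2), min_le_max⟩ : OrdPair S) ∈ (c.support : Set _) := by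
        simpa using hp
      rcases le_total p.1 p.2 with h | h
      · exact Or.inl ⟨_, hp', by simp [h]⟩
      · exact Or.inr ⟨_, ⟨_, hp', rfl⟩, by simp [h]⟩
    have hsum : Summable fun p : S × S =>
        |(c ⟨(min p.1 p.2, max p.1 p.2), min_le_max⟩ : ℝ)| := summable_of_hasFiniteSupport hfin
    refine ⟨⟨fun s ℓ => ?_, fun s => ?_⟩, ?_⟩
    · simp only [min_comm, max_comm]
    · exact (hsum.prod_factor s).subtype _
    · exact hsum.subtype _⟩

theorem ofFinsupp_apply (c : OrdPair S →₀ ℚ) (p : OrdPair S) :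
    ofFinsupp c p.1.1 p.1.2 = c p := by
  obtain ⟨⟨s, ℓ⟩, h : s ≤ ℓ⟩ := p
  change ((c ⟨(min s ℓ, max s ℓ), min_le_max⟩ : ℚ) : ℝ) = _
  simp only [min_eq_left h, max_eq_right h]

theorem exists_finset_support (c : OrdPair S →₀ ℚ) :
    ∃ F : Finset S, ∀ s ℓ, ofFinsupp c s ℓ ≠ 0 → s ∈ F ∧ ℓ ∈ F := by
  classical
  refine ⟨c.support.image (fun p => p.1.1) ∪ c.support.image (fun p => p.1.2), ?_⟩
  have key : ∀ s ℓ, s ≤ ℓ → ofFinsupp c s ℓ ≠ 0 →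
      s ∈ c.support.image (fun p => p.1.1) ∧ ℓ ∈ c.support.image (fun p => p.1.2) := by
    intro s ℓ h hne
    have hp : (⟨(s, ℓ), h⟩ : OrdPair S) ∈ c.support := by
      rw [ofFinsupp_apply c ⟨(s, ℓ), h⟩] at hne
      simpa using hne
    exact ⟨Finset.mem_image.2 ⟨_, hp, rfl⟩, Finset.mem_image.2 ⟨_, hp, rfl⟩⟩
  intro s ℓ hne
  rcases le_total s ℓ with h | h
  · obtain ⟨h1, h2⟩ := key s ℓ h hne
    exact ⟨Finset.mem_union_left _ h1, Finset.mem_union_right _ h2⟩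
  · rw [symm] at hne
    obtain ⟨h1, h2⟩ := key ℓ s h hne
    exact ⟨Finset.mem_union_right _ h2, Finset.mem_union_left _ h1⟩

theorem norm_sub_ofFinsupp (θ : M1 S) (c : OrdPair S →₀ ℚ) :
    HasSum (fun p : OrdPair S => |θ p.1.1 p.1.2 - c p|) ‖θ - ofFinsupp c‖ := by
  have h : ∀ p : OrdPair S, |(θ - ofFinsupp c : M1 S) p.1.1 p.1.2| = |θ p.1.1 p.1.2 - c p| :=
    fun p => by
      rw [← ofFinsupp_apply c p]
      rfl
  exact (funext h : _ = fun p : OrdPair S => |θ p.1.1 p.1.2 - c p|) ▸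
    (θ - ofFinsupp c).summable.hasSum

/-- Cut off a tail of mass below `ε / 2`, then round the remaining entries to rationals. -/
theorem dense_range_ofFinsupp : Dense (Set.range (ofFinsupp : (OrdPair S →₀ ℚ) → M1 S)) := by
  classical
  rw [Metric.dense_iff]
  intro θ ε hε
  obtain ⟨F, hF⟩ := ((tendsto_order.1 (tendsto_tsum_compl_atTop_zero
    fun p : OrdPair S => |θ p.1.1 p.1.2|)).2 (ε / 2) (half_pos hε)).exists
  -- Rounding errors over `F` then total at most `ε / 2`; the `+ 1` covers empty `F`.
  have hδ : 0 < ε / (2 * (F.card + 1)) := by positivity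
  choose r hr using fun p : OrdPair S => exists_rat_near (θ p.1.1 p.1.2) hδ
  set c : OrdPair S →₀ ℚ := Finsupp.onFinset F (fun p => if p ∈ F then r p else 0)
    fun p hp => by by_contra h; simp [h] at hp
  refine ⟨ofFinsupp c, ?_, _, rfl⟩
  have hs := norm_sub_ofFinsupp θ c
  rw [Metric.mem_ball, dist_comm, dist_eq_norm, ← hs.tsum_eq,
    ← hs.summable.sum_add_tsum_subtype_compl F]
  have h1 : ∑ p ∈ F, |θ p.1.1 p.1.2 - c p| ≤ ε / 2 := by
    refine (Finset.sum_le_card_nsmul F _ (ε / (2 * (F.card + 1))) fun p hp => ?_).trans ?_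
    · rw [show c p = r p from if_pos hp]
      exact (hr p).le
    · rw [nsmul_eq_mul, mul_div_assoc', div_le_div_iff₀ (by positivity) two_pos]
      nlinarith
  have h2 : ∑' p : {p // p ∉ F}, |θ p.1.1.1 p.1.1.2 - c p| < ε / 2 := by
    refine lt_of_eq_of_lt (tsum_congr fun p => ?_) hF
    rw [show c p = 0 from if_neg p.2, Rat.cast_zero, sub_zero]
  linarith

end M1

/-! ### Lipschitz bounds on `M1` and the law of large numbers -/

namespace AutoModel.IsBoundedBy

variable {𝕏 : Type*} [MeasurableSpace 𝕏] {S : Type*} [LinearOrder S] [Countable S]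
  {E : AutoModel 𝕏} {C : ℝ} (hE : E.IsBoundedBy C) [NeZero E.ρ] {θs : S → S → ℝ}
  (hθs : RowSummable θs) {μ : Measure (S → 𝕏)} (hμ : E.IsFieldLaw θs μ)

include hE hθs

section KL

include hμ

theorem abs_condKL_sub_le (θ θ' : M1 S) (s : S) :
    |E.condKL μ θs θ s - E.condKL μ θs θ' s| ≤ 4 * C * rowSum (θ - θ' : M1 S) s := by
  have := hμ.1
  rw [hE.condKL_eq_integral_logRatio hθs θ.rowSummable s hμ,
    hE.condKL_eq_integral_logRatio hθs θ'.rowSummable s hμ,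
    ← integral_sub (hE.integrable_logRatio hθs θ.rowSummable _ s μ)
      (hE.integrable_logRatio hθs θ'.rowSummable _ s μ)]
  rw [M1.coe_sub]
  simpa using norm_integral_le_of_norm_le_const (μ := μ)
    (f := fun x => E.logRatio θs θ {s}ᶜ s x - E.logRatio θs θ' {s}ᶜ s x) (Eventually.of_forall
      fun x => hE.abs_logRatio_sub_le hθs θ.rowSummable {s}ᶜ s θ'.rowSummable x)

theorem condKL_eq_zero {θ : S → S → ℝ} (hθ : RowSummable θ) {s : S} (h : θ s = 0) :
    E.condKL μ θs θ s = 0 := by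
  rw [hE.condKL_eq_integral_logRatio hθs hθ s hμ]
  simp [logRatio_eq_zero h]

/-- Comparison with the zero perturbation, whose divergence vanishes, dominates the terms by
multiples of the summable row sums. -/
theorem summable_condKL (θ : M1 S) : Summable fun s => E.condKL μ θs θ s := by
  refine Summable.of_norm_bounded (θ.summable_rowSum.mul_left (4 * C)) fun s => ?_
  have h := hE.abs_condKL_sub_le hθs hμ θ 0 s
  rwa [hE.condKL_eq_zero hθs hμ (θ := (0 : M1 S)) (0 : M1 S).rowSummable rfl, sub_zero,
    sub_zero] at h

theorem abs_totalKL_sub_le (θ θ' : M1 S) :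
    |E.totalKL μ θs θ - E.totalKL μ θs θ'| ≤ 8 * C * dist θ θ' := by
  have := hμ.1
  -- A field configuration and a node give a point of the sample space, where the bound on `A`
  -- forces `0 ≤ C`. Without nodes both sides vanish.
  obtain ⟨x⟩ := μ.nonempty_of_neZero
  rcases isEmpty_or_nonempty S with hS | ⟨⟨s⟩⟩
  · have : dist θ θ' = 0 := by simp [dist_eq_norm, M1.norm_def]
    simp [totalKL, this]
  have hC : 0 ≤ C := (abs_nonneg _).trans (hE.abs_A_le (x s))
  rw [totalKL, totalKL, ← (hE.summable_condKL hθs hμ θ).tsum_sub (hE.summable_condKL hθs hμ θ')]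
  refine (tsum_of_norm_bounded (f := fun s => E.condKL μ θs θ s - E.condKL μ θs θ' s)
    ((θ - θ').summable_rowSum.mul_left (4 * C)).hasSum
    fun s => hE.abs_condKL_sub_le hθs hμ θ θ' s).trans ?_
  rw [tsum_mul_left, dist_eq_norm]
  nlinarith [(θ - θ').tsum_rowSum_le]

end KL

/-- The penalized contrast is Lipschitz when the penalty is. -/
theorem abs_contrast_sub_le (hC : 0 ≤ C) (D : Finset S) {q : ℝ → ℝ} {R : ℝ} (hR : 0 ≤ R)
    (hq : ∀ x y, 0 ≤ x → 0 ≤ y → |q x - q y| ≤ R * |x - y|) (n : ℕ) (x : ℕ → S → 𝕏)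
    (θ θ' : M1 S) :
    |E.contrast D q θs n x θ - E.contrast D q θs n x θ'| ≤ (8 * C + R / n) * dist θ θ' := by
  have h1 : ∀ i, |∑ s ∈ D, E.logRatio θs θ (D \ {s}) s (x i)
      - ∑ s ∈ D, E.logRatio θs θ' (D \ {s}) s (x i)| ≤ 8 * C * dist θ θ' := fun i => by
    rw [← Finset.sum_sub_distrib]
    refine (Finset.abs_sum_le_sum_abs _ _).trans ((Finset.sum_le_sum fun s _ =>
      hE.abs_logRatio_sub_le hθs θ.rowSummable _ s θ'.rowSummable (x i)).trans ?_)
    rw [← Finset.mul_sum, dist_eq_norm]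
    have := (θ - θ').sum_rowSum_le D
    rw [M1.coe_sub] at this
    nlinarith
  have h2 : |(n : ℝ)⁻¹ * ∑ i ∈ Finset.range n, ∑ s ∈ D, E.logRatio θs θ (D \ {s}) s (x i)
      - (n : ℝ)⁻¹ * ∑ i ∈ Finset.range n, ∑ s ∈ D, E.logRatio θs θ' (D \ {s}) s (x i)|
      ≤ 8 * C * dist θ θ' := by
    rw [← mul_sub, ← Finset.sum_sub_distrib, abs_mul, abs_of_nonneg (by positivity)]
    refine (mul_le_mul_of_nonneg_left ((Finset.abs_sum_le_sum_abs _ _).trans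
      (Finset.sum_le_sum fun i _ => h1 i)) (by positivity)).trans ?_
    rw [Finset.sum_const, Finset.card_range, nsmul_eq_mul, ← mul_assoc]
    -- Also valid for `n = 0`, where the inverse is 0 by convention.
    exact mul_le_of_le_one_left (by positivity) inv_mul_le_one
  have h3 : |(n : ℝ)⁻¹ * ∑ p ∈ (D ×ˢ D).filter (fun p => p.1 ≤ p.2),
        (q |θs p.1 p.2 + θ p.1 p.2| - q |θs p.1 p.2|)
      - (n : ℝ)⁻¹ * ∑ p ∈ (D ×ˢ D).filter (fun p => p.1 ≤ p.2),
        (q |θs p.1 p.2 + θ' p.1 p.2| - q |θs p.1 p.2|)| ≤ R / n * dist θ θ' := by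
    rw [← mul_sub, abs_mul, abs_of_nonneg (by positivity), div_eq_inv_mul, mul_assoc]
    exact mul_le_mul_of_nonneg_left (M1.abs_sum_penalty_sub_le θ θ' θs _ hR hq) (by positivity)
  have h4 : ∀ θ : M1 S, E.contrast D q θs n x θ
      = (n : ℝ)⁻¹ * ∑ i ∈ Finset.range n, ∑ s ∈ D, E.logRatio θs θ (D \ {s}) s (x i)
        + (n : ℝ)⁻¹ * ∑ p ∈ (D ×ˢ D).filter (fun p => p.1 ≤ p.2),
          (q |θs p.1 p.2 + θ p.1 p.2| - q |θs p.1 p.2|) := fun _ => rfl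
  rw [h4, h4, add_sub_add_comm, add_mul]
  exact (abs_add_le _ _).trans (add_le_add h2 h3)

/-- The strong law of large numbers for the log-likelihood ratio at a node. -/
theorem ae_tendsto_average_logRatio (hμ : E.IsFieldLaw θs μ) {θ : S → S → ℝ}
    (hθ : RowSummable θ) (s : S) {Ω : Type*} [MeasurableSpace Ω] {P : Measure Ω}
    [IsProbabilityMeasure P] {X : ℕ → Ω → S → 𝕏} (hX : ∀ i, Measurable (X i))
    (hindep : iIndepFun X P) (hlaw : ∀ i, P.map (X i) = μ) :
    ∀ᵐ ω ∂P, Tendsto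
      (fun n : ℕ => (∑ i ∈ Finset.range n, E.logRatio θs θ {s}ᶜ s (X i ω)) / n) atTop
      (𝓝 (E.condKL μ θs θ s)) := by
  have hm := hE.measurable_logRatio (θs := θs) (θ := θ) {s}ᶜ s
  have := hμ.1
  have hint : Integrable (fun ω => E.logRatio θs θ {s}ᶜ s (X 0 ω)) P := by
    have h := hE.integrable_logRatio hθs hθ {s}ᶜ s μ
    rw [← hlaw 0] at h
    exact h.comp_measurable (hX 0)
  have h := strong_law_ae_real (fun i ω => E.logRatio θs θ {s}ᶜ s (X i ω)) hint
    (fun i j hij => (hindep.indepFun hij).comp hm hm)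
    (fun i => IdentDistrib.comp (f := X i) (g := X 0)
      ⟨(hX i).aemeasurable, (hX 0).aemeasurable, by rw [hlaw, hlaw]⟩ hm)
  rwa [hE.condKL_eq_integral_logRatio hθs hθ s hμ, ← hlaw 0,
    integral_map (hX 0).aemeasurable hm.aestronglyMeasurable]

omit [Countable S] [NeZero E.ρ] hE hθs in
/-- For a finitely supported perturbation of a sparse network, the approximate log-likelihood
ratio is eventually a sum of full log-likelihood ratios over a fixed finite set of nodes. -/
theorem eventually_sum_logRatio_eq (hsparse : ∀ s, (matNeighborhood θs s).Finite)
    {θ : S → S → ℝ} {F : Finset S} (hF : ∀ s ℓ, θ s ℓ ≠ 0 → s ∈ F ∧ ℓ ∈ F)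
    {D : ℕ → Finset S} (hDmono : Monotone D) (hDunion : ∀ s, ∃ n, s ∈ D n) :
    ∀ᶠ n in atTop, ∀ x : S → 𝕏, ∑ s ∈ D n, E.logRatio θs θ (D n \ {s}) s x
      = ∑ s ∈ F, E.logRatio θs θ {s}ᶜ s x := by
  -- Once `D n` contains `F` and all true neighbors of `F`, no node of `F` has an unobserved
  -- neighbor under either network. Nodes outside `F` have a zero row in `θ` and contribute nothing.
  set M : Finset S := F ∪ F.biUnion fun s => (hsparse s).toFinset with hM
  have hD : ∀ s ∈ M, ∀ᶠ n in atTop, s ∈ D n := fun s _ => by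
    obtain ⟨n, hn⟩ := hDunion s
    filter_upwards [eventually_ge_atTop n] with k hk using hDmono hk hn
  filter_upwards [(Finset.eventually_all M).2 hD] with n hn x
  refine (Finset.sum_subset (fun s hs => hn s (Finset.mem_union_left _ hs))
    fun s _ hs => logRatio_eq_zero ?_ _ x).symm.trans (Finset.sum_congr rfl fun s hs => ?_)
  · funext ℓ
    by_contra h
    exact hs (hF s ℓ h).1
  · refine logRatio_eq_full (fun ℓ hℓ => hℓ.2)
      (fun ℓ hℓ h => Set.mem_sdiff_singleton.2 ⟨hn ℓ ?_, hℓ⟩) x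
    rcases h with h | h
    · exact Finset.mem_union_right _ (Finset.mem_biUnion.2
        ⟨s, hs, (hsparse s).mem_toFinset.2 ⟨hℓ, h⟩⟩)
    · exact Finset.mem_union_left _ (hF s ℓ h).2

end AutoModel.IsBoundedBy

/-! ### The epi-convergence theorem -/

open AutoModel in
theorem theorem2
    -- the compact sample space and the known functions of the model
    {m : ℕ} (K : Set (EuclideanSpace ℝ (Fin m))) (hK : IsCompact K)
    (E : AutoModel K) (hρ : IsFiniteMeasure E.ρ)
    (hA : Measurable E.A) (hB₀ : Measurable E.B₀) (hB : Measurable (Function.uncurry E.B))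
    (hBsymm : ∀ x y, E.B x y = E.B y x) (hBdiag : ∀ x, E.B x x = E.B₀ x)
    (hAbdd : ∃ C : ℝ, ∀ x, |E.A x| ≤ C) (hB₀bdd : ∃ C : ℝ, ∀ x, |E.B₀ x| ≤ C)
    (hBbdd : ∃ C : ℝ, ∀ x y, |E.B x y| ≤ C)
    -- the countably infinite set of nodes, the true network, and a law of the field
    {S : Type*} [LinearOrder S] [Countable S] [Infinite S]
    (θs : S → S → ℝ) (hθs : θs ∈ InfMat S) (hsparse : ∀ s, (matNeighborhood θs s).Finite)
    (μ : Measure (S → K)) (hμ : E.IsFieldLaw θs μ)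
    -- the i.i.d. fields with that law
    {Ω : Type*} [MeasurableSpace Ω] (P : Measure Ω) [IsProbabilityMeasure P]
    (X : ℕ → Ω → S → K) (hXmeas : ∀ i, Measurable (X i)) (hXindep : iIndepFun X P)
    (hXlaw : ∀ i, P.map (X i) = μ)
    -- the observed domains
    (D : ℕ → Finset S) (hDmono : Monotone D) (hDunion : ∀ s, ∃ n, s ∈ D n)
    -- the penalty functions and the regularization parameters
    (q : ℝ → ℝ → ℝ) (hq : IsPenaltyFamily q)
    (lam : ℕ → ℝ) (hlam_pos : ∀ n, 1 ≤ n → 0 < lam n)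
    (hlam : Tendsto (fun n : ℕ => lam n / n) atTop (𝓝 0)) :
    (∀ θ : M1 S, Summable fun s => E.condKL μ θs θ s) ∧
    ∀ᵐ ω ∂P, EpiConverges
      (fun (n : ℕ) (θ : M1 S) =>
        ((E.contrast (D n) (q (lam n)) θs n (fun i => X i ω) θ : ℝ) : EReal))
      (fun θ : M1 S => ((E.totalKL μ θs θ : ℝ) : EReal)) := by
  have : NeZero E.ρ := ⟨hμ.ρ_ne_zero⟩
  obtain ⟨C₁, hC₁⟩ := hAbdd
  obtain ⟨C₂, hC₂⟩ := hB₀bdd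
  obtain ⟨C₃, hC₃⟩ := hBbdd
  obtain ⟨C, hC, hE⟩ : ∃ C, 0 ≤ C ∧ E.IsBoundedBy C :=
    ⟨max 0 (max C₁ (max C₂ C₃)), le_max_left _ _, hρ, hA, hB₀, hB,
      fun x => (hC₁ x).trans (by simp), fun x => (hC₂ x).trans (by simp),
      fun x y => (hC₃ x y).trans (by simp)⟩
  have hθs' : RowSummable θs := fun s => by
    refine summable_of_hasFiniteSupport (((hsparse s).insert s).subset fun ℓ hℓ => ?_)
    by_cases h : ℓ = s
    · exact Or.inl h
    · exact Or.inr ⟨h, by simpa using hℓ⟩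
  refine ⟨hE.summable_condKL hθs' hμ, ?_⟩
  obtain ⟨R, hR, hqR⟩ := hq.exists_lipschitz
  have hRlam : Tendsto (fun n : ℕ => R * lam n / n) atTop (𝓝 0) := by
    simpa [mul_div_assoc] using hlam.const_mul R
  -- Rational coefficients and countably many nodes: a countable union of null sets is null.
  have hae : ∀ᵐ ω ∂P, ∀ (c : OrdPair S →₀ ℚ) (s : S), Tendsto (fun n : ℕ =>
      (∑ i ∈ Finset.range n, E.logRatio θs (M1.ofFinsupp c) {s}ᶜ s (X i ω)) / n) atTop
      (𝓝 (E.condKL μ θs (M1.ofFinsupp c) s)) :=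
    ae_all_iff.2 fun c => ae_all_iff.2 fun s =>
      hE.ae_tendsto_average_logRatio hθs' hμ (M1.rowSummable _) s hXmeas hXindep hXlaw
  filter_upwards [hae] with ω hω
  have hlip : ∀ᶠ n in atTop, ∀ θ θ' : M1 S,
      |E.contrast (D n) (q (lam n)) θs n (fun i => X i ω) θ
        - E.contrast (D n) (q (lam n)) θs n (fun i => X i ω) θ'| ≤ (8 * C + 1) * dist θ θ' := by
    -- The penalty's Lipschitz constant `R * lam n / n` is eventually at most 1, whence `8 * C + 1`.
    filter_upwards [eventually_ge_atTop 1, hRlam.eventually_le_const one_pos] with n hn hn' θ θ'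
    have hl := hlam_pos n hn
    refine (hE.abs_contrast_sub_le hθs' hC (D n) (by positivity) (hqR _ hl) n _ θ θ').trans ?_
    gcongr
  refine epiConverges_of_tendsto_of_lipschitz hlip (tendsto_of_dense_of_lipschitz
    M1.dense_range_ofFinsupp hlip (hE.abs_totalKL_sub_le hθs' hμ) ?_)
  rintro _ ⟨c, rfl⟩
  obtain ⟨F, hF⟩ := M1.exists_finset_support c
  have hk : E.totalKL μ θs (M1.ofFinsupp c) = ∑ s ∈ F, E.condKL μ θs (M1.ofFinsupp c) s := by
    refine tsum_eq_sum fun s hs => hE.condKL_eq_zero hθs' hμ (M1.rowSummable _) (funext fun ℓ => ?_)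
    by_contra h
    exact hs (hF s ℓ h).1
  have hpen : Tendsto (fun n : ℕ => (n : ℝ)⁻¹ * ∑ p ∈ (D n ×ˢ D n).filter (fun p => p.1 ≤ p.2),
      (q (lam n) |θs p.1 p.2 + M1.ofFinsupp c p.1 p.2| - q (lam n) |θs p.1 p.2|)) atTop (𝓝 0) := by
    refine squeeze_zero_norm' (a := fun n : ℕ => R * lam n / n * ‖M1.ofFinsupp c‖) ?_
      (by simpa using hRlam.mul_const ‖M1.ofFinsupp c‖)
    filter_upwards [eventually_ge_atTop 1] with n hn
    have hl := hlam_pos n hn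
    -- Against the zero perturbation the penalty difference is the whole penalty term.
    have h := M1.abs_sum_penalty_sub_le (M1.ofFinsupp c) 0 θs (D n ×ˢ D n)
      (R := R * lam n) (by positivity) (hqR _ hl)
    simp only [M1.coe_zero, Pi.zero_apply, add_zero, sub_self, Finset.sum_const_zero, sub_zero,
      dist_zero_right] at h
    rw [Real.norm_eq_abs, abs_mul, abs_of_nonneg (by positivity), div_eq_inv_mul, mul_assoc]
    exact mul_le_mul_of_nonneg_left h (by positivity)
  have hlog : Tendsto (fun n : ℕ => ∑ s ∈ F,
      (∑ i ∈ Finset.range n, E.logRatio θs (M1.ofFinsupp c) {s}ᶜ s (X i ω)) / n) atTop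
      (𝓝 (E.totalKL μ θs (M1.ofFinsupp c))) := by
    rw [hk]
    exact tendsto_finsetSum F fun s _ => hω c s
  have hsum := hlog.add hpen
  rw [add_zero] at hsum
  refine hsum.congr' ?_
  filter_upwards [IsBoundedBy.eventually_sum_logRatio_eq (E := E) hsparse hF hDmono hDunion]
    with n hn
  rw [contrast]
  congr 1
  rw [← Finset.sum_div, Finset.sum_comm, div_eq_inv_mul]
  exact congrArg _ (Finset.sum_congr rfl fun i _ => (hn (X i ω)).symm)
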